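/- Let $\mathcal H\neq\{0\}$ be a complex Hilbert space of finite or countably infinite dimension, and write $\mathcal L(\mathcal H)$ for its bounded operators. An observable $\mathsf A$ on $\mathcal H$ is a sequence of positive operators $\mathsf A(x)\in\mathcal L(\mathcal H)$, $x\in\mathbb N$, with $\sum_x\mathsf A(x)=\mathbb 1$ (weakly). For a Hilbert space $\mathcal K$, a channel $\Lambda:\mathcal L(\mathcal K)\to\mathcal L(\mathcal H)$ is a normal completely positive linear map with $\Lambda(\mathbb 1)=\mathbb 1$; let $\mathfrak C$ be the collection of all channels into $\mathcal L(\mathcal H)$, with an arbitrary output Hilbert space. For $\Lambda_1,\Lambda_2\in\mathfrak C$ write $\Lambda_1\precsim\Lambda_2$ if $\Lambda_1=\Lambda_2\circ\mathcal E$ for some channel $\mathcal E$ between the respective output algebras. This is a preorder; let $\sim$ be the induced equivalence relation, $[\Lambda]$ the class of $\Lambda$, and $\mathfrak C^\sim=\mathfrak C/{\sim}$ with the induced partial order $\precsim$. A channel $\Lambda:\mathcal L(\mathcal K)\to\mathcal L(\mathcal H)$ is an $\mathsf A$-channel if there are normal completely positive linear maps $\mathcal I_x:\mathcal L(\mathcal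 K)\to\mathcal L(\mathcal H)$, $x\in\mathbb N$, with $\mathcal I_x(\mathbb 1)=\mathsf A(x)$ for all $x$ and $\sum_x\mathcal I_x(C)=\Lambda(C)$ (weakly) for all $C\in\mathcal L(\mathcal K)$. Let $\mathfrak C_{\mathsf A}$ be the set of all $\mathsf A$-channels and $\mathfrak C_{\mathsf A}^\sim=\{[\Lambda]\mid\Lambda\in\mathfrak C_{\mathsf A}\}$. **Theorem.** Let $\mathsf A$ be an observable on $\mathcal H$ and let $(\mathcal K,\hat{\mathsf A},K)$ be a Naimark dilation of $\mathsf A$, that is, $\mathcal K$ is a Hilbert space, $K:\mathcal H\to\mathcal K$ an isometry and $\hat{\mathsf A}$ a projection-valued observable on $\mathcal K$ with $K^*\hat{\mathsf A}(x)K=\mathsf A(x)$ for all $x$. Then $$\Lambda_{\mathsf A}(C)=\sum_x K^*\hat{\mathsf A}(x)\,C\,\hat{\mathsf A}(x)K\qquad(C\in\mathcal L(\mathcal K)),$$ where the sum converges weakly, defines a channel $\Lambda_{\mathsf A}:\mathcal L(\mathcal K)\to\mathcal L(\mathcal H)$, and $$\mathfrak C_{\mathsf A}=\{\Lambda\in\mathfrak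 C\mid\Lambda\precsim\Lambda_{\mathsf A}\}.$$ In particular $\Lambda_{\mathsf A}$ is a least disturbing $\mathsf A$-channel (it is an $\mathsf A$-channel, and every $\mathsf A$-channel is of the form $\Lambda_{\mathsf A}\circ\mathcal E$ for a channel $\mathcal E$), $[\Lambda_{\mathsf A}]$ is the greatest element of $\mathfrak C_{\mathsf A}^\sim$, and $$\mathfrak C_{\mathsf A}^\sim=\{[\Lambda]\in\mathfrak C^\sim\mid[\Lambda]\precsim[\Lambda_{\mathsf A}]\},$$ that is, $\mathfrak C_{\mathsf A}^\sim$ is the principal ideal of $\mathfrak C^\sim$ generated by $[\Lambda_{\mathsf A}]$. -/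

import Mathlib

open scoped InnerProductSpace CStarAlgebra ComplexOrder

universe u v

namespace QuantumMeasurement

/-- The operators `T i` are (unconditionally) summable to `S` in the weak operator topology. -/
def HasWeakSum {ι : Type*} {H : Type*} [NormedAddCommGroup H] [InnerProductSpace ℂ H]
    (T : ι → H →L[ℂ] H) (S : H →L[ℂ] H) : Prop :=
  ∀ φ ψ : H, HasSum (fun i => ⟪φ, T i ψ⟫_ℂ) ⟪φ, S ψ⟫_ℂ

/-- An observable (discrete POVM) on `H` with outcomes in `ℕ`: the effects are positive operators
(`≤` is the Loewner order) that sum up to the identity. Some of them may vanish, so that observables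
with finitely many outcomes are included. -/
structure Observable (H : Type u) [NormedAddCommGroup H] [InnerProductSpace ℂ H]
    [CompleteSpace H] where
  /-- the effect of an outcome -/
  effect : ℕ → H →L[ℂ] H
  effect_nonneg : ∀ x, 0 ≤ effect x
  sum_effect : HasWeakSum effect (1 : H →L[ℂ] H)

/-- A normal completely positive linear map from the bounded operators on `K` to the bounded
operators on `H`. Normality: suprema of upward directed families of operators are preserved. -/
structure NormalCPMap (K : Type v) (H : Type u)
    [NormedAddCommGroup K] [InnerProductSpace ℂ K] [CompleteSpace K]
    [NormedAddCommGroup H] [InnerProductSpace ℂ H] [CompleteSpace H] where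
  /-- the underlying completely positive map -/
  toCP : (K →L[ℂ] K) →CP (H →L[ℂ] H)
  normal : ScottContinuous toCP

/-- A channel in the Heisenberg picture, with output space `K` and input space `H`: a unital normal
completely positive map from the bounded operators on `K` to the bounded operators on `H`. -/
structure Channel (K : Type v) (H : Type u)
    [NormedAddCommGroup K] [InnerProductSpace ℂ K] [CompleteSpace K]
    [NormedAddCommGroup H] [InnerProductSpace ℂ H] [CompleteSpace H]
    extends NormalCPMap K H where
  map_one : toCP 1 = 1

section

variable {K : Type*} [NormedAddCommGroup K] [InnerProductSpace ℂ K] [CompleteSpace K]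
  {H : Type*} [NormedAddCommGroup H] [InnerProductSpace ℂ H] [CompleteSpace H]
  {L : Type*} [NormedAddCommGroup L] [InnerProductSpace ℂ L] [CompleteSpace L]

noncomputable instance : CoeFun (NormalCPMap K H) (fun _ => (K →L[ℂ] K) → (H →L[ℂ] H)) where
  coe Φ := ⇑Φ.toCP

noncomputable instance : CoeFun (Channel K H) (fun _ => (K →L[ℂ] K) → (H →L[ℂ] H)) where
  coe Φ := ⇑Φ.toCP

/-- The identity channel. -/
noncomputable def Channel.id (H : Type*) [NormedAddCommGroup H] [InnerProductSpace ℂ H]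
    [CompleteSpace H] :
    Channel H H where
  toCP :=
    { (LinearMap.id : (H →L[ℂ] H) →ₗ[ℂ] (H →L[ℂ] H)) with
      map_cstarMatrix_nonneg' := fun _ _ hM => hM }
  normal := ScottContinuous.id
  map_one := rfl

/-- The composition `Φ ∘ E` of channels. -/
noncomputable def Channel.comp (Φ : Channel K H) (E : Channel L K) : Channel L H where
  toCP :=
    { Φ.toCP.toLinearMap.comp E.toCP.toLinearMap with
      map_cstarMatrix_nonneg' := fun k M hM =>
        Φ.toCP.map_cstarMatrix_nonneg' k _ (E.toCP.map_cstarMatrix_nonneg' k M hM) }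
  normal := ScottContinuous.comp (g := fun C => Φ.toCP C) (f := fun C => E.toCP C)
    E.normal Φ.normal
  map_one := (congrArg (fun C => Φ.toCP C) E.map_one).trans Φ.map_one

/-- An instrument in the Heisenberg picture: a family of normal completely positive maps whose
pointwise sum is a channel (the total channel of the instrument). -/
structure Instrument (K : Type*) (H : Type*)
    [NormedAddCommGroup K] [InnerProductSpace ℂ K] [CompleteSpace K]
    [NormedAddCommGroup H] [InnerProductSpace ℂ H] [CompleteSpace H] where
  /-- the operation of an outcome -/
  op : ℕ → NormalCPMap K H
  /-- the total channel -/
  total : Channel K H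
  hasWeakSum_op : ∀ C : K →L[ℂ] K, HasWeakSum (fun x => op x C) (total C)

/-- `Λ` is an `A`-channel: it is the total channel of an instrument with
`I_x(1) = A(x)` for all `x`. -/
def IsAChannel (A : Observable H) (Λ : Channel K H) : Prop :=
  ∃ I : Instrument K H, (∀ x, I.op x 1 = A.effect x) ∧ I.total = Λ

/-- A Naimark dilation of `A` on the Hilbert space `K`: an isometry `J : H → K` and a
projection-valued measure `pvm` on `K` with `J* pvm(x) J = A(x)` for all `x`. -/
structure NaimarkDilation (A : Observable H) (K : Type*)
    [NormedAddCommGroup K] [InnerProductSpace ℂ K] [CompleteSpace K] where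
  /-- the projection-valued measure -/
  pvm : Observable K
  isStarProjection_pvm : ∀ x, IsStarProjection (pvm.effect x)
  /-- the isometry -/
  isom : H →ₗᵢ[ℂ] K
  compress : ∀ x, ContinuousLinearMap.adjoint isom.toContinuousLinearMap ∘L
    pvm.effect x ∘L isom.toContinuousLinearMap = A.effect x

/-- The operator `J* pvm(x) C pvm(x) J` of a Naimark dilation. -/
noncomputable def NaimarkDilation.term {A : Observable H} (D : NaimarkDilation A K) (x : ℕ)
    (C : K →L[ℂ] K) : H →L[ℂ] H :=
  ContinuousLinearMap.adjoint D.isom.toContinuousLinearMap ∘L D.pvm.effect x ∘L C ∘L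
    D.pvm.effect x ∘L D.isom.toContinuousLinearMap

end

/-- The channels with input space `H` and an arbitrary output Hilbert space. -/
structure ChannelTo (H : Type u) [NormedAddCommGroup H] [InnerProductSpace ℂ H]
    [CompleteSpace H] where
  /-- the output space -/
  Out : Type v
  [instNormed : NormedAddCommGroup Out]
  [instInner : InnerProductSpace ℂ Out]
  [instComplete : CompleteSpace Out]
  /-- the channel -/
  chan : Channel Out H

attribute [instance] ChannelTo.instNormed ChannelTo.instInner ChannelTo.instComplete

section

variable {H : Type u} [NormedAddCommGroup H] [InnerProductSpace ℂ H] [CompleteSpace H]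

/-- `Λ₁ ≤ Λ₂` if `Λ₁ = Λ₂ ∘ E` for some channel `E`. -/
instance : Preorder (ChannelTo.{u, v} H) where
  le Λ₁ Λ₂ := ∃ E : Channel Λ₁.Out Λ₂.Out, Λ₁.chan = Λ₂.chan.comp E
  le_refl Λ := ⟨Channel.id Λ.Out, rfl⟩
  le_trans := by
    rintro Λ₁ Λ₂ Λ₃ ⟨E, hE⟩ ⟨F, hF⟩
    exact ⟨F.comp E, by rw [hE, hF]; rfl⟩

/-- The partially ordered set of equivalence classes of channels, where `Λ₁` and `Λ₂` are
equivalent if `Λ₁ ≤ Λ₂` and `Λ₂ ≤ Λ₁`. -/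
abbrev ChannelClass (H : Type u) [NormedAddCommGroup H] [InnerProductSpace ℂ H]
    [CompleteSpace H] :=
  Antisymmetrization (ChannelTo.{u, v} H) (· ≤ ·)

/-- The equivalence class of a channel. -/
def channelClass (Λ : ChannelTo.{u, v} H) : ChannelClass.{u, v} H :=
  toAntisymmetrization (· ≤ ·) Λ

/-- The set of all `A`-channels. -/
def aChannels (A : Observable H) : Set (ChannelTo.{u, v} H) :=
  {Λ | IsAChannel A Λ.chan}

/-- The set of equivalence classes of `A`-channels. -/
def aChannelClasses (A : Observable H) : Set (ChannelClass.{u, v} H) :=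
  channelClass '' aChannels A

end

end QuantumMeasurement

open QuantumMeasurement

/-! Put `V_x = pvm(x) J`, so that `V_x* V_x = A(x)` and the channel `Λ_A` is the weak sum of the
maps `C ↦ V_x* C V_x`. For a channel `E`, the maps `C ↦ V_x* E(C) V_x` form an instrument with
effects `A(x)` and total channel `Λ_A ∘ E`.

Conversely, let an instrument satisfy `I_x(1) = V_x* V_x`. The Schwarz inequality `|⟪φ, I_x(C) ψ⟫| ≤
‖C‖ ‖V_x φ‖ ‖V_x ψ‖` shows that `I_x(C)` factors as `V_x* F_x(C) V_x`, with `F_x` normal, completely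
positive and unital on the closed range of `V_x`. This closure may be smaller than the range of
`pvm(x)`; a completely positive term on the gap yields `F_x(1) = pvm(x)`. Then `E = ∑ F_x` is a
channel, and orthogonality of the projections gives `V_x* E(C) V_x = I_x(C)`. Summing over `x` gives
the total channel as `Λ_A ∘ E`. The statements about classes are order theory.

The analytic weight is on `NormalCPMap.norm_inner_le` (Schwarz), `NormalCPMap.exists_hasWeakSum`
(sums of normal maps) and `NormalCPMap.exists_map_one_eq_of_isStarProjection` (the maps `F_x`). -/

namespace QuantumMeasurement
open Filter Topology ContinuousLinearMap

/-! ### Positivity and weak limits through quadratic forms -/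

section Forms
variable {H : Type*} [NormedAddCommGroup H] [InnerProductSpace ℂ H]

theorem clm_le_iff_inner {S T : H →L[ℂ] H} : S ≤ T ↔ ∀ φ, ⟪φ, S φ⟫_ℂ ≤ ⟪φ, T φ⟫_ℂ := by
  rw [ContinuousLinearMap.le_def]
  constructor
  · intro h φ
    have := h.inner_nonneg_right φ
    rwa [sub_apply, inner_sub_right, sub_nonneg] at this
  · intro h
    rw [ContinuousLinearMap.isPositive_iff_complex]
    intro φ
    have h1 : 0 ≤ ⟪φ, (T - S) φ⟫_ℂ := by
      rw [sub_apply, inner_sub_right, sub_nonneg]; exact h φ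
    have h2 : 0 ≤ ⟪(T - S) φ, φ⟫_ℂ := by
      rw [← inner_conj_symm]
      exact star_nonneg_iff.mpr h1
    rw [Complex.nonneg_iff] at h2
    refine ⟨?_, h2.1⟩
    exact Complex.ext rfl h2.2

theorem clm_nonneg_iff_inner {T : H →L[ℂ] H} : 0 ≤ T ↔ ∀ φ, 0 ≤ ⟪φ, T φ⟫_ℂ := by
  simp [clm_le_iff_inner]

variable [CompleteSpace H]

theorem exists_eq_adjoint_comp_self {T : H →L[ℂ] H} (hT : 0 ≤ T) :
    ∃ S : H →L[ℂ] H, T = adjoint S ∘L S :=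
  CStarAlgebra.nonneg_iff_eq_star_mul_self.mp hT

theorem sum_inner_star_mul_self_nonneg {k : ℕ} (N : CStarMatrix (Fin k) (Fin k) (H →L[ℂ] H))
    (v : Fin k → H) :
    0 ≤ ∑ i, ∑ j, ⟪v i, (star N * N) i j (v j)⟫_ℂ := by
  have h : ∑ i, ∑ j, ⟪v i, (star N * N) i j (v j)⟫_ℂ
      = ∑ l, ⟪∑ i, N l i (v i), ∑ j, N l j (v j)⟫_ℂ := by
    simp only [CStarMatrix.mul_apply, CStarMatrix.star_apply, sum_apply, inner_sum, sum_inner,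
      star_eq_adjoint, mul_apply_eq_comp, adjoint_inner_right]
    rw [Finset.sum_comm_cycle]
    exact Finset.sum_congr rfl fun _ _ => Finset.sum_comm
  rw [h]
  refine Finset.sum_nonneg fun l _ => ?_
  exact clm_nonneg_iff_inner.mp zero_le_one _

/-- For the converse, the matrix is assembled into one positive operator `T` on the `k`-fold Hilbert
sum; the blocks of `S` in `T = S* S` form `N` with `M = N* N`. -/
theorem cstarMatrix_nonneg_iff {k : ℕ} {M : CStarMatrix (Fin k) (Fin k) (H →L[ℂ] H)} :
    0 ≤ M ↔ ∀ v : Fin k → H, 0 ≤ ∑ i, ∑ j, ⟪v i, M i j (v j)⟫_ℂ := by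
  constructor
  · intro h v
    rw [StarOrderedRing.nonneg_iff] at h
    induction h using AddSubmonoid.closure_induction with
    | mem _ hM => obtain ⟨N, rfl⟩ := hM; exact sum_inner_star_mul_self_nonneg N v
    | zero => simp
    | add _ _ _ _ h₁ h₂ =>
      simpa only [CStarMatrix.add_apply, add_apply, inner_add_right, Finset.sum_add_distrib] using
        add_nonneg h₁ h₂
  · intro h
    let π : Fin k → (PiLp 2 fun _ : Fin k => H) →L[ℂ] H := fun i => PiLp.proj 2 _ i
    have hsum : ∑ i, adjoint (π i) ∘L π i = 1 := by
      refine ContinuousLinearMap.ext fun w => ext_inner_left ℂ fun u => ?_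
      simp only [sum_apply, inner_sum, comp_apply, adjoint_inner_right, PiLp.inner_apply, π,
        one_apply_eq_self, PiLp.proj_apply]
    have hδ : ∀ i j, π i ∘L adjoint (π j) = if i = j then 1 else 0 := by
      intro i j
      have hs : ∀ y, adjoint (π j) y = PiLp.single 2 j y := by
        intro y
        refine ext_inner_left ℂ fun u => ?_
        simp only [adjoint_inner_right, PiLp.inner_apply, π, PiLp.proj_apply]
        rw [Finset.sum_eq_single j]
        · simp
        · intro b _ hb; simp [hb]
        · simp
      ext y
      rw [comp_apply, hs]
      by_cases hij : i = j
      · subst hij; simp [π]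
      · simp [π, hij]
    let T := ∑ i, ∑ j, adjoint (π i) ∘L M i j ∘L π j
    have hT : 0 ≤ T := by
      rw [clm_nonneg_iff_inner]
      intro w
      simpa only [T, sum_apply, inner_sum, comp_apply, adjoint_inner_right] using
        h fun i => π i w
    obtain ⟨S, hS⟩ := exists_eq_adjoint_comp_self hT
    let N : CStarMatrix (Fin k) (Fin k) (H →L[ℂ] H) :=
      CStarMatrix.ofMatrix fun i j => π i ∘L S ∘L adjoint (π j)
    have hM : M = star N * N := by
      ext1 i j
      have h1 : M i j = π i ∘L T ∘L adjoint (π j) := by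
        have : π i ∘L T ∘L adjoint (π j) = ∑ a, ∑ b,
            (π i ∘L adjoint (π a)) ∘L M a b ∘L (π b ∘L adjoint (π j)) := by
          ext y
          simp [T, map_sum]
        rw [this]
        simp only [hδ]
        rw [Finset.sum_eq_single i, Finset.sum_eq_single j]
        · ext; simp
        · intro b _ hb; ext; simp [hb]
        · simp
        · intro b _ hb; ext; simp [Ne.symm hb]
        · simp
      have h2 : (star N * N) i j = π i ∘L adjoint S ∘L (∑ l, adjoint (π l) ∘L π l) ∘L S
          ∘L adjoint (π j) := by
        ext y
        have hN : ∀ i j, N i j = π i ∘L S ∘L adjoint (π j) := fun _ _ => rfl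
        simp [CStarMatrix.mul_apply, CStarMatrix.star_apply, hN, star_eq_adjoint, adjoint_comp,
          map_sum]
      rw [h1, h2, hsum, hS]
      rfl
    rw [hM]
    exact star_mul_self_nonneg N

/-- Sesquilinearity passes to pointwise limits, and a bounded sesquilinear form is given by an
operator. -/
theorem exists_clm_of_tendsto {α : Type*} {l : Filter α} [l.NeBot] {T : α → H →L[ℂ] H}
    {f : H → H → ℂ} (hT : ∀ φ ψ, Tendsto (fun a => ⟪φ, T a ψ⟫_ℂ) l (𝓝 (f φ ψ))) {M : ℝ}
    (hf : ∀ φ ψ, ‖f φ ψ‖ ≤ M * ‖φ‖ * ‖ψ‖) : ∃ S : H →L[ℂ] H, ∀ φ ψ, ⟪φ, S ψ⟫_ℂ = f φ ψ := by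
  let B : H →ₗ⋆[ℂ] H →ₗ[ℂ] ℂ := LinearMap.mk₂'ₛₗ (starRingEnd ℂ) (RingHom.id ℂ) f
    (fun φ φ' ψ => tendsto_nhds_unique (hT _ _) (by
      simpa only [inner_add_left] using (hT φ ψ).add (hT φ' ψ)))
    (fun c φ ψ => tendsto_nhds_unique (hT _ _) (by
      simpa only [inner_smul_left, smul_eq_mul] using (hT φ ψ).const_mul (starRingEnd ℂ c)))
    (fun φ ψ ψ' => tendsto_nhds_unique (hT _ _) (by
      simpa only [map_add, inner_add_right] using (hT φ ψ).add (hT φ ψ')))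
    (fun c φ ψ => tendsto_nhds_unique (hT _ _) (by
      simpa only [map_smul, inner_smul_right, smul_eq_mul, RingHom.id_apply] using
        (hT φ ψ).const_mul c))
  let B' : H →L⋆[ℂ] H →L[ℂ] ℂ := B.mkContinuous₂ M hf
  refine ⟨adjoint (InnerProductSpace.continuousLinearMapOfBilin B'), fun φ ψ => ?_⟩
  rw [adjoint_inner_right, InnerProductSpace.continuousLinearMapOfBilin_apply]
  rfl

/-- Vigier's theorem: along an upward directed family of operators with least upper bound `a`,
the distances `a - c` are eventually bounded and tend to zero weakly. -/
theorem norm_le_and_tendsto_of_isLUB {d : Set (H →L[ℂ] H)} (hne : d.Nonempty)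
    (hd : DirectedOn (· ≤ ·) d) {a : H →L[ℂ] H} (ha : IsLUB d a) :
    (∃ M : ℝ, ∀ᶠ c : d in atTop, ‖(c : H →L[ℂ] H)‖ ≤ M) ∧
    ∀ φ ψ, Tendsto (fun c : d => ⟪φ, (c : H →L[ℂ] H) ψ⟫_ℂ) atTop (𝓝 ⟪φ, a ψ⟫_ℂ) := by
  have : Nonempty d := hne.to_subtype
  have : IsDirectedOrder d := directedOn_iff_isDirectedOrder.mp hd
  obtain ⟨c₀⟩ := ‹Nonempty d›
  have hpos : ∀ c : d, 0 ≤ a - c := fun c => sub_nonneg.mpr (ha.1 c.2)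
  have hanti : ∀ c c' : d, c ≤ c' → a - (c' : H →L[ℂ] H) ≤ a - c :=
    fun c c' h => sub_le_sub_left (show (c : H →L[ℂ] H) ≤ c' from h) a
  have hbd : ∀ c : d, c₀ ≤ c → ‖a - (c : H →L[ℂ] H)‖ ≤ ‖a - (c₀ : H →L[ℂ] H)‖ := fun c h =>
    CStarAlgebra.norm_le_norm_of_nonneg_of_le (hpos c) (hanti _ _ h)
  refine ⟨⟨‖a‖ + ‖a - (c₀ : H →L[ℂ] H)‖, ?_⟩, ?_⟩
  · filter_upwards [eventually_ge_atTop c₀] with c hc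
    calc ‖(c : H →L[ℂ] H)‖ = ‖a - (a - c)‖ := by rw [sub_sub_cancel]
      _ ≤ ‖a‖ + ‖a - (c : H →L[ℂ] H)‖ := norm_sub_le _ _
      _ ≤ _ := by gcongr; exact hbd c hc
  -- On the diagonal the net is decreasing and bounded below by zero; polarization then handles all
  -- pairs.
  have hdiag : ∀ φ, ∃ q : ℂ,
      Tendsto (fun c : d => ⟪(a - (c : H →L[ℂ] H)) φ, φ⟫_ℂ) atTop (𝓝 q) := by
    intro φ
    have hp : ∀ c : d, 0 ≤ ⟪(a - (c : H →L[ℂ] H)) φ, φ⟫_ℂ := fun c =>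
      ((ContinuousLinearMap.nonneg_iff_isPositive _).mp (hpos c)).inner_nonneg_left φ
    have hr : ∀ c : d, ⟪(a - (c : H →L[ℂ] H)) φ, φ⟫_ℂ
        = ((⟪(a - (c : H →L[ℂ] H)) φ, φ⟫_ℂ).re : ℂ) := by
      intro c
      exact Complex.ext rfl (Complex.nonneg_iff.mp (hp c)).2.symm
    have hmono : Antitone fun c : d => (⟪(a - (c : H →L[ℂ] H)) φ, φ⟫_ℂ).re := by
      intro c c' h
      have := (sub_nonneg.mpr (hanti c c' h))
      have := ((ContinuousLinearMap.nonneg_iff_isPositive _).mp this).inner_nonneg_left φ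
      rw [sub_apply, inner_sub_left, sub_nonneg] at this
      exact (Complex.le_def.mp this).1
    have hlim := tendsto_atTop_ciInf hmono ⟨0, by
      rintro _ ⟨c, rfl⟩; exact (Complex.nonneg_iff.mp (hp c)).1⟩
    exact ⟨_, ((Complex.continuous_ofReal.tendsto _).comp hlim).congr fun c => (hr c).symm⟩
  choose q hq using hdiag
  have hoff : ∀ φ ψ, ∃ z : ℂ,
      Tendsto (fun c : d => ⟪φ, (a - (c : H →L[ℂ] H)) ψ⟫_ℂ) atTop (𝓝 z) := by
    intro φ ψ
    have hs : ∀ c : d, ⟪φ, (a - (c : H →L[ℂ] H)) ψ⟫_ℂ = ⟪(a - (c : H →L[ℂ] H)) φ, ψ⟫_ℂ := fun c =>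
      (((ContinuousLinearMap.nonneg_iff_isPositive _).mp (hpos c)).inner_left_eq_inner_right
        φ ψ).symm
    simp only [hs]
    have := fun c : d => inner_map_polarization' (a - (c : H →L[ℂ] H)).toLinearMap φ ψ
    simp only [coe_coe] at this
    simp only [this]
    exact ⟨_, ((((hq _).sub (hq _)).sub ((hq _).const_mul _)).add
      ((hq _).const_mul _)).div_const _⟩
  choose f hf using hoff
  have hfb : ∀ φ ψ, ‖f φ ψ‖ ≤ ‖a - (c₀ : H →L[ℂ] H)‖ * ‖φ‖ * ‖ψ‖ := by
    intro φ ψ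
    refine le_of_tendsto (hf φ ψ).norm ?_
    filter_upwards [eventually_ge_atTop c₀] with c hc
    calc _ ≤ ‖φ‖ * ‖(a - (c : H →L[ℂ] H)) ψ‖ := norm_inner_le_norm _ _
      _ ≤ ‖φ‖ * (‖a - (c₀ : H →L[ℂ] H)‖ * ‖ψ‖) := by
        gcongr
        exact (le_opNorm _ _).trans (by gcongr; exact hbd c hc)
      _ = _ := by ring
  obtain ⟨S, hS⟩ := exists_clm_of_tendsto hf hfb
  -- The weak limit satisfies `S ≥ 0`, and `a - S` is an upper bound of `d`, so `a ≤ a - S`.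
  have hS0 : S = 0 := by
    refine le_antisymm ?_ (clm_nonneg_iff_inner.mpr fun φ => ?_)
    · have hub : a - S ∈ upperBounds d := by
        intro c hc
        rw [le_sub_comm, clm_le_iff_inner]
        intro φ
        rw [hS]
        refine le_of_tendsto (hf φ φ) ?_
        filter_upwards [eventually_ge_atTop (⟨c, hc⟩ : d)] with c' hc'
        exact clm_le_iff_inner.mp (hanti _ _ hc') φ
      simpa using ha.2 hub
    · rw [hS]
      exact ge_of_tendsto' (hf φ φ) fun c => clm_nonneg_iff_inner.mp (hpos c) φ
  intro φ ψ
  have h0 : f φ ψ = 0 := by rw [← hS, hS0]; simp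
  have := (hf φ ψ).const_sub ⟪φ, a ψ⟫_ℂ
  rw [h0, sub_zero] at this
  refine this.congr fun c => ?_
  rw [sub_apply, inner_sub_right, sub_sub_cancel]

end Forms

/-! ### Normal completely positive maps: Schwarz inequality and weak sums -/

namespace NormalCPMap
variable {K : Type*} [NormedAddCommGroup K] [InnerProductSpace ℂ K]
  {H : Type*} [NormedAddCommGroup H] [InnerProductSpace ℂ H]

theorem scottContinuous_of_tendsto {F : (K →L[ℂ] K) → H →L[ℂ] H} (hmono : Monotone F)
    (hF : ∀ (d : Set (K →L[ℂ] K)) (a : K →L[ℂ] K), d.Nonempty → DirectedOn (· ≤ ·) d → IsLUB d a →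
      ∀ φ, Tendsto (fun c : d => ⟪φ, F c φ⟫_ℂ) atTop (𝓝 ⟪φ, F a φ⟫_ℂ)) : ScottContinuous F := by
  intro d hne hd a ha
  refine ⟨?_, fun b hb => clm_le_iff_inner.mpr fun φ => ?_⟩
  · rintro _ ⟨c, hc, rfl⟩
    exact hmono (ha.1 hc)
  · have : Nonempty d := hne.to_subtype
    have : IsDirectedOrder d := directedOn_iff_isDirectedOrder.mp hd
    exact le_of_tendsto' (hF d a hne hd ha φ) fun c =>
      clm_le_iff_inner.mp (hb (Set.mem_image_of_mem F c.2)) φ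

variable [CompleteSpace K] [CompleteSpace H]
  {L : Type*} [NormedAddCommGroup L] [InnerProductSpace ℂ L] [CompleteSpace L]

theorem sum_inner_nonneg (Φ : NormalCPMap K H) {k : ℕ}
    {M : CStarMatrix (Fin k) (Fin k) (K →L[ℂ] K)} (hM : 0 ≤ M) (v : Fin k → H) :
    0 ≤ ∑ i, ∑ j, ⟪v i, Φ (M i j) (v j)⟫_ℂ :=
  cstarMatrix_nonneg_iff.mp (Φ.toCP.map_cstarMatrix_nonneg' k M hM) v

theorem ext {Φ Ψ : NormalCPMap K H} (h : ∀ C, Φ C = Ψ C) : Φ = Ψ := by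
  obtain ⟨Φ, _⟩ := Φ
  obtain ⟨Ψ, _⟩ := Ψ
  obtain rfl : Φ = Ψ := DFunLike.ext _ _ h
  rfl

/-- The quadratic form at `v` is at least `‖C‖ (‖v 0‖ - ‖v 1‖)²`. -/
theorem cstarMatrix_two_nonneg (C : K →L[ℂ] K) :
    0 ≤ (CStarMatrix.ofMatrix !![((‖C‖ : ℂ) • 1 : K →L[ℂ] K), C; adjoint C, (‖C‖ : ℂ) • 1] :
      CStarMatrix (Fin 2) (Fin 2) (K →L[ℂ] K)) := by
  rw [cstarMatrix_nonneg_iff]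
  intro v
  have h : ∑ i, ∑ j, ⟪v i, (CStarMatrix.ofMatrix !![((‖C‖ : ℂ) • 1 : K →L[ℂ] K), C; adjoint C,
        (‖C‖ : ℂ) • 1] : CStarMatrix (Fin 2) (Fin 2) (K →L[ℂ] K)) i j (v j)⟫_ℂ
      = ((‖C‖ * (‖v 0‖ ^ 2 + ‖v 1‖ ^ 2) + 2 * (⟪v 0, C (v 1)⟫_ℂ).re : ℝ) : ℂ) := by
    have h1 : ⟪v 1, adjoint C (v 0)⟫_ℂ = starRingEnd ℂ ⟪v 0, C (v 1)⟫_ℂ := by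
      rw [adjoint_inner_right, inner_conj_symm]
    have h2 := Complex.add_conj ⟪v 0, C (v 1)⟫_ℂ
    simp only [Fin.sum_univ_two, CStarMatrix.ofMatrix_apply, Matrix.cons_val_zero,
      Matrix.cons_val_one, Matrix.of_apply, smul_apply, one_apply_eq_self, inner_smul_right,
      inner_self_eq_norm_sq_to_K, h1]
    push_cast at h2 ⊢
    simp only [Complex.coe_algebraMap]
    linear_combination h2
  rw [h, Complex.zero_le_real]
  have h3 : -(‖v 0‖ * (‖C‖ * ‖v 1‖)) ≤ (⟪v 0, C (v 1)⟫_ℂ).re := by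
    have h4 := (Complex.abs_re_le_norm ⟪v 0, C (v 1)⟫_ℂ).trans (norm_inner_le_norm _ _)
    have h5 : ‖v 0‖ * ‖C (v 1)‖ ≤ ‖v 0‖ * (‖C‖ * ‖v 1‖) := by gcongr; exact le_opNorm _ _
    linarith [neg_abs_le (⟪v 0, C (v 1)⟫_ℂ).re]
  nlinarith [mul_nonneg (norm_nonneg C) (sq_nonneg (‖v 0‖ - ‖v 1‖))]

theorem map_adjoint (Φ : NormalCPMap K H) (C : K →L[ℂ] K) : Φ (adjoint C) = adjoint (Φ C) :=
  map_star Φ.toCP C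

/-- The Schwarz inequality for completely positive maps. -/
theorem norm_inner_le (Φ : NormalCPMap K H) {V : H →L[ℂ] L} (hV : Φ 1 = adjoint V ∘L V)
    (C : K →L[ℂ] K) (φ ψ : H) : ‖⟪φ, Φ C ψ⟫_ℂ‖ ≤ ‖C‖ * ‖V φ‖ * ‖V ψ‖ := by
  have key : ∀ φ ψ, 0 ≤ ‖C‖ * (‖V φ‖ ^ 2 + ‖V ψ‖ ^ 2) + 2 * (⟪φ, Φ C ψ⟫_ℂ).re := by
    intro φ ψ
    have h := Φ.sum_inner_nonneg (cstarMatrix_two_nonneg C) ![φ, ψ]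
    have h1 : ⟪ψ, Φ (adjoint C) φ⟫_ℂ = starRingEnd ℂ ⟪φ, Φ C ψ⟫_ℂ := by
      rw [map_adjoint, adjoint_inner_right, inner_conj_symm]
    have h2 := Complex.add_conj ⟪φ, Φ C ψ⟫_ℂ
    simp only [Fin.sum_univ_two, CStarMatrix.ofMatrix_apply, Matrix.cons_val_zero,
      Matrix.cons_val_one, Matrix.of_apply, map_smul, smul_apply, inner_smul_right, h1, hV,
      comp_apply, adjoint_inner_right, inner_self_eq_norm_sq_to_K, Complex.coe_algebraMap] at h
    rw [← Complex.zero_le_real]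
    convert h using 1
    push_cast at h2 ⊢
    linear_combination -h2
  -- The phase `w` makes the cross term negative. Scaling `φ` by a real `s` in `key` then gives a
  -- nonnegative quadratic in `s`, whose discriminant condition is the claim.
  obtain ⟨w, hw, hwz⟩ : ∃ w : ℂ, ‖w‖ = 1 ∧ w * ⟪φ, Φ C ψ⟫_ℂ = -‖⟪φ, Φ C ψ⟫_ℂ‖ := by
    obtain ⟨w, hw, h⟩ := Complex.exists_norm_mul_eq_self ⟪φ, Φ C ψ⟫_ℂ
    refine ⟨-starRingEnd ℂ w, by simpa using hw, ?_⟩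
    have h2 : starRingEnd ℂ w * w = 1 := by
      rw [mul_comm, Complex.mul_conj, Complex.normSq_eq_norm_sq, hw]; simp
    nth_rw 1 [← h]
    linear_combination -(‖⟪φ, Φ C ψ⟫_ℂ‖ : ℂ) * h2
  have hq : ∀ s : ℝ, 0 ≤ (‖C‖ * ‖V φ‖ ^ 2) * (s * s) + (-2 * ‖⟪φ, Φ C ψ⟫_ℂ‖) * s
      + ‖C‖ * ‖V ψ‖ ^ 2 := by
    intro s
    have h := key ((s : ℂ) • φ) (w • ψ)
    have h2 : ⟪(s : ℂ) • φ, Φ C (w • ψ)⟫_ℂ = ((-(s * ‖⟪φ, Φ C ψ⟫_ℂ‖) : ℝ) : ℂ) := by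
      rw [map_smul, inner_smul_left, inner_smul_right, hwz]
      simp
    rw [h2] at h
    simp only [map_smul, norm_smul, hw, Complex.norm_real, Real.norm_eq_abs, mul_pow, sq_abs,
      Complex.ofReal_re, one_pow] at h
    nlinarith
  have hd := discrim_le_zero hq
  rw [discrim] at hd
  refine le_of_sq_le_sq ?_ (by positivity)
  nlinarith

theorem monotone_of_sum_inner_nonneg {F : (K →L[ℂ] K) →ₗ[ℂ] H →L[ℂ] H}
    (hpos : ∀ (k : ℕ) (M : CStarMatrix (Fin k) (Fin k) (K →L[ℂ] K)), 0 ≤ M →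
      ∀ v : Fin k → H, 0 ≤ ∑ i, ∑ j, ⟪v i, F (M i j) (v j)⟫_ℂ) : Monotone F := by
  intro C C' h
  rw [← sub_nonneg, ← map_sub, clm_nonneg_iff_inner]
  intro φ
  have h1 : 0 ≤ (CStarMatrix.ofMatrix fun _ _ => C' - C :
      CStarMatrix (Fin 1) (Fin 1) (K →L[ℂ] K)) := by
    rw [cstarMatrix_nonneg_iff]
    intro v
    simpa only [Fin.sum_univ_one] using! clm_nonneg_iff_inner.mp (sub_nonneg.mpr h) (v 0)
  simpa only [Fin.sum_univ_one] using! hpos 1 _ h1 fun _ => φ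

/-- Construct a normal completely positive map from quadratic form conditions. -/
def ofForm (F : (K →L[ℂ] K) →ₗ[ℂ] H →L[ℂ] H)
    (hpos : ∀ (k : ℕ) (M : CStarMatrix (Fin k) (Fin k) (K →L[ℂ] K)), 0 ≤ M →
      ∀ v : Fin k → H, 0 ≤ ∑ i, ∑ j, ⟪v i, F (M i j) (v j)⟫_ℂ)
    (hF : ScottContinuous F) : NormalCPMap K H where
  toCP :=
    { F with
      map_cstarMatrix_nonneg' := fun k M hM => cstarMatrix_nonneg_iff.mpr (hpos k M hM) }
  normal := hF

theorem monotone (Φ : NormalCPMap K H) : Monotone fun C => Φ C :=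
  Φ.normal.monotone

/-- Vigier's theorem applies to the image of `d`, onto which `d` maps monotonically and
surjectively, hence cofinally. -/
theorem tendsto_of_isLUB (Φ : NormalCPMap K H) {d : Set (K →L[ℂ] K)} {a : K →L[ℂ] K}
    (hne : d.Nonempty) (hd : DirectedOn (· ≤ ·) d) (ha : IsLUB d a) (φ ψ : H) :
    Tendsto (fun c : d => ⟪φ, Φ c ψ⟫_ℂ) atTop (𝓝 ⟪φ, Φ a ψ⟫_ℂ) := by
  have h := (norm_le_and_tendsto_of_isLUB (hne.image _) (hd.mono_comp Φ.monotone)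
    (Φ.normal hne hd ha)).2 φ ψ
  have hm : Monotone fun c : d => (⟨Φ c, Set.mem_image_of_mem _ c.2⟩ : (fun C => Φ C) '' d) :=
    fun c c' hc => Φ.monotone hc
  refine h.comp (tendsto_atTop_atTop_of_monotone hm ?_)
  rintro ⟨_, c, hc, rfl⟩
  exact ⟨⟨c, hc⟩, le_rfl⟩

/-- The map `C ↦ W† C W`. -/
noncomputable def conj (W : H →L[ℂ] K) : NormalCPMap K H :=
  have hpos : ∀ (k : ℕ) (M : CStarMatrix (Fin k) (Fin k) (K →L[ℂ] K)), 0 ≤ M →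
      ∀ v : Fin k → H, 0 ≤ ∑ i, ∑ j, ⟪v i, (adjoint W ∘L M i j ∘L W) (v j)⟫_ℂ := by
    intro k M hM v
    simpa only [comp_apply, adjoint_inner_right] using
      cstarMatrix_nonneg_iff.mp hM fun i => W (v i)
  let F : (K →L[ℂ] K) →ₗ[ℂ] H →L[ℂ] H :=
    { toFun C := adjoint W ∘L C ∘L W
      map_add' _ _ := by ext; simp
      map_smul' _ _ := by ext; simp }
  ofForm F hpos <| scottContinuous_of_tendsto (monotone_of_sum_inner_nonneg (F := F) hpos) <| by
    intro d a hne hd ha φ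
    simpa only [F, LinearMap.coe_mk, AddHom.coe_mk, comp_apply, adjoint_inner_right] using
      (norm_le_and_tendsto_of_isLUB hne hd ha).2 (W φ) (W φ)

theorem conj_apply (W : H →L[ℂ] K) (C : K →L[ℂ] K) : conj W C = adjoint W ∘L C ∘L W := rfl

/-- The composition of normal completely positive maps. -/
noncomputable def comp (Φ : NormalCPMap K H) (E : NormalCPMap L K) : NormalCPMap L H where
  toCP :=
    { Φ.toCP.toLinearMap.comp E.toCP.toLinearMap with
      map_cstarMatrix_nonneg' := fun k M hM =>
        Φ.toCP.map_cstarMatrix_nonneg' k _ (E.toCP.map_cstarMatrix_nonneg' k M hM) }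
  normal := ScottContinuous.comp (g := fun C => Φ.toCP C) (f := fun C => E.toCP C)
    E.normal Φ.normal

theorem comp_apply (Φ : NormalCPMap K H) (E : NormalCPMap L K) (C : L →L[ℂ] L) :
    Φ.comp E C = Φ (E C) := rfl

/-- Summability at the unit suffices: with `F i 1 = V_i* V_i` the Schwarz inequality dominates the
terms at `C` by `‖C‖ ‖V_i φ‖ ‖V_i ψ‖`, and `∑ ‖V_i φ‖² = ⟪φ, T φ⟫`. -/
theorem exists_hasWeakSum {ι : Type*} (F : ι → NormalCPMap K H) {T : H →L[ℂ] H}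
    (hT : HasWeakSum (fun i => F i 1) T) :
    ∃ Φ : NormalCPMap K H, ∀ C, HasWeakSum (fun i => F i C) (Φ C) := by
  have hnn : ∀ i, 0 ≤ F i 1 := fun i => by
    have := (F i).monotone (zero_le_one (α := K →L[ℂ] K))
    dsimp only at this
    rwa [show F i 0 = 0 from map_zero _] at this
  choose V hV using fun i => exists_eq_adjoint_comp_self (hnn i)
  have hsq : ∀ φ, HasSum (fun i => ‖V i φ‖ ^ 2) (⟪φ, T φ⟫_ℂ).re := by
    intro φ
    refine (Complex.hasSum_re (hT φ φ)).congr_fun fun i => ?_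
    simp only [hV, ContinuousLinearMap.comp_apply, adjoint_inner_right, inner_self_eq_norm_sq_to_K]
    norm_cast
  have hbd : ∀ C φ ψ i, ‖⟪φ, F i C ψ⟫_ℂ‖ ≤ ‖C‖ * ‖V i φ‖ * ‖V i ψ‖ := fun C φ ψ i =>
    (F i).norm_inner_le (hV i) C φ ψ
  have hsummable : ∀ φ ψ, Summable fun i => ‖V i φ‖ * ‖V i ψ‖ := fun φ ψ =>
    Summable.of_nonneg_of_le (fun _ => by positivity)
      (fun i => by
        nlinarith [sq_nonneg (‖V i φ‖ - ‖V i ψ‖), sq_nonneg (‖V i φ‖), sq_nonneg (‖V i ψ‖)])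
      ((hsq φ).summable.add (hsq ψ).summable)
  have hs : ∀ C φ ψ, Summable fun i => ⟪φ, F i C ψ⟫_ℂ := fun C φ ψ =>
    Summable.of_norm_bounded (((hsummable φ ψ).mul_left ‖C‖)) fun i => by
      rw [← mul_assoc]; exact hbd C φ ψ i
  have hbound : ∀ C φ ψ, ‖∑' i, ⟪φ, F i C ψ⟫_ℂ‖ ≤ ‖C‖ * ‖T‖ * ‖φ‖ * ‖ψ‖ := by
    intro C φ ψ
    have hTn : ∀ φ, √(∑' i, ‖V i φ‖ ^ 2) ≤ √‖T‖ * ‖φ‖ := by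
      intro φ
      rw [(hsq φ).tsum_eq]
      refine Real.sqrt_le_iff.mpr ⟨by positivity, ?_⟩
      rw [mul_pow, Real.sq_sqrt (norm_nonneg _)]
      calc _ ≤ ‖φ‖ * ‖T φ‖ := (Complex.re_le_norm _).trans (norm_inner_le_norm _ _)
        _ ≤ ‖φ‖ * (‖T‖ * ‖φ‖) := by gcongr; exact le_opNorm _ _
        _ = _ := by ring
    have hCS : ∑' i, ‖V i φ‖ * ‖V i ψ‖ ≤ √(∑' i, ‖V i φ‖ ^ 2) * √(∑' i, ‖V i ψ‖ ^ 2) := by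
      have := Real.inner_le_Lp_mul_Lq_tsum_of_nonneg (p := 2) (q := 2)
        ⟨by norm_num, by norm_num, by norm_num⟩
        (fun i => norm_nonneg (V i φ)) (fun i => norm_nonneg (V i ψ))
        (by simpa using (hsq φ).summable) (by simpa using (hsq ψ).summable)
      simpa [Real.sqrt_eq_rpow] using this
    calc ‖∑' i, ⟪φ, F i C ψ⟫_ℂ‖ ≤ ∑' i, ‖C‖ * (‖V i φ‖ * ‖V i ψ‖) :=
          tsum_of_norm_bounded ((hsummable φ ψ).mul_left ‖C‖).hasSum fun i => by
            rw [← mul_assoc]; exact hbd C φ ψ i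
      _ = ‖C‖ * ∑' i, ‖V i φ‖ * ‖V i ψ‖ := tsum_mul_left
      _ ≤ ‖C‖ * ((√‖T‖ * ‖φ‖) * (√‖T‖ * ‖ψ‖)) := by
        gcongr
        exact hCS.trans (by gcongr <;> exact hTn _)
      _ = ‖C‖ * (√‖T‖ * √‖T‖) * ‖φ‖ * ‖ψ‖ := by ring
      _ = _ := by rw [Real.mul_self_sqrt (norm_nonneg _)]
  have hex : ∀ C, ∃ S : H →L[ℂ] H, ∀ φ ψ, ⟪φ, S ψ⟫_ℂ = ∑' i, ⟪φ, F i C ψ⟫_ℂ := fun C =>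
    exists_clm_of_tendsto (T := fun s : Finset ι => ∑ i ∈ s, F i C) (l := atTop)
      (fun φ ψ => by simpa only [sum_apply, inner_sum, HasSum] using! (hs C φ ψ).hasSum) (hbound C)
  choose S hS using hex
  let Fs : (K →L[ℂ] K) →ₗ[ℂ] H →L[ℂ] H :=
    { toFun := S
      map_add' C C' := ContinuousLinearMap.ext fun ψ => ext_inner_left ℂ fun φ => by
        simp only [hS, add_apply, inner_add_right, map_add, (hs C φ ψ).tsum_add (hs C' φ ψ)]
      map_smul' c C := ContinuousLinearMap.ext fun ψ => ext_inner_left ℂ fun φ => by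
        simp only [hS, smul_apply, inner_smul_right, map_smul, tsum_mul_left, RingHom.id_apply] }
  have hpos : ∀ (k : ℕ) (M : CStarMatrix (Fin k) (Fin k) (K →L[ℂ] K)), 0 ≤ M →
      ∀ v : Fin k → H, 0 ≤ ∑ i, ∑ j, ⟪v i, Fs (M i j) (v j)⟫_ℂ := by
    intro k M hM v
    have h : HasSum (fun x => ∑ i, ∑ j, ⟪v i, F x (M i j) (v j)⟫_ℂ)
        (∑ i, ∑ j, ⟪v i, Fs (M i j) (v j)⟫_ℂ) :=
      hasSum_sum fun i _ => hasSum_sum fun j _ => by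
        have := (hs (M i j) (v i) (v j)).hasSum
        rwa [← hS] at this
    exact h.nonneg fun x => (F x).sum_inner_nonneg hM v
  refine ⟨ofForm Fs hpos <| scottContinuous_of_tendsto (monotone_of_sum_inner_nonneg hpos) ?_,
    fun C φ ψ => ?_⟩
  · intro d a hne hd ha φ
    obtain ⟨M, hM⟩ := (norm_le_and_tendsto_of_isLUB hne hd ha).1
    have : ∀ C, ⟪φ, Fs C φ⟫_ℂ = ∑' i, ⟪φ, F i C φ⟫_ℂ := fun C => hS C φ φ
    simp only [this]
    -- Normality of the sum exchanges limit and sum; the domination is uniform because directed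
    -- families with a supremum are eventually norm bounded.
    refine tendsto_tsum_of_dominated_convergence ((hsummable φ φ).mul_left M)
      (fun i => (F i).tendsto_of_isLUB hne hd ha φ φ) ?_
    filter_upwards [hM] with c hc i
    refine (hbd c φ φ i).trans ?_
    rw [mul_assoc]
    gcongr
  · have := (hs C φ ψ).hasSum
    rwa [← hS] at this

end NormalCPMap

/-! ### Operators determined on a dense range -/

section
variable {H : Type*} [NormedAddCommGroup H] [InnerProductSpace ℂ H]

theorem HasWeakSum.unique {ι : Type*} {T : ι → H →L[ℂ] H} {S S' : H →L[ℂ] H}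
    (h : HasWeakSum T S) (h' : HasWeakSum T S') : S = S' :=
  ContinuousLinearMap.ext fun ψ => ext_inner_left ℂ fun φ => (h φ ψ).unique (h' φ ψ)

variable {K : Type*} [NormedAddCommGroup K] [InnerProductSpace ℂ K]
  {V : H →L[ℂ] K}

theorem clm_ext_of_denseRange (hV : DenseRange V) {S T : K →L[ℂ] K}
    (h : ∀ φ ψ, ⟪V φ, S (V ψ)⟫_ℂ = ⟪V φ, T (V ψ)⟫_ℂ) : S = T := by
  refine ContinuousLinearMap.ext fun η => ?_
  refine hV.induction_on (p := fun η => S η = T η) η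
    (isClosed_eq S.continuous T.continuous) fun ψ => ext_inner_left ℂ fun ξ => ?_
  exact hV.induction_on (p := fun ξ => ⟪ξ, S (V ψ)⟫_ℂ = ⟪ξ, T (V ψ)⟫_ℂ) ξ
    (isClosed_eq (by fun_prop) (by fun_prop)) fun φ => h φ ψ

theorem clm_le_of_denseRange (hV : DenseRange V) {S T : K →L[ℂ] K}
    (h : ∀ φ, ⟪V φ, S (V φ)⟫_ℂ ≤ ⟪V φ, T (V φ)⟫_ℂ) : S ≤ T :=
  clm_le_iff_inner.mpr fun ξ =>
    hV.induction_on (p := fun ξ => ⟪ξ, S ξ⟫_ℂ ≤ ⟪ξ, T ξ⟫_ℂ) ξ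
      (isClosed_le (by fun_prop) (by fun_prop)) h

variable {L : Type*} [NormedAddCommGroup L] [InnerProductSpace ℂ L] [CompleteSpace L]

/-- An operator dominated by `V` factors through `V`. -/
theorem exists_comp_eq_of_norm_le (hV : DenseRange V) {X : H →L[ℂ] L} {M : ℝ}
    (hX : ∀ ψ, ‖X ψ‖ ≤ M * ‖V ψ‖) : ∃ Y : K →L[ℂ] L, ∀ ψ, Y (V ψ) = X ψ :=
  ⟨X.toLinearMap.extendOfNorm V.toLinearMap, fun ψ =>
    LinearMap.extendOfNorm_eq (f := X.toLinearMap) (e := V.toLinearMap) hV ⟨M, hX⟩ ψ⟩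

variable [CompleteSpace H] [CompleteSpace K]

/-- A sesquilinear form dominated by `V` comes from a bounded operator on the range of `V`. -/
theorem exists_inner_eq_of_norm_inner_le (hV : DenseRange V) {X : H →L[ℂ] H} {M : ℝ} (hM : 0 ≤ M)
    (hX : ∀ φ ψ, ‖⟪φ, X ψ⟫_ℂ‖ ≤ M * ‖V φ‖ * ‖V ψ‖) :
    ∃ S : K →L[ℂ] K, ∀ φ ψ, ⟪V φ, S (V ψ)⟫_ℂ = ⟪φ, X ψ⟫_ℂ := by
  -- `V` is split off twice: `X = Y V`, then `Y* = Z V`, so `X = V* Z* V`. Each bound comes from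
  -- testing the form on the vector to be estimated.
  obtain ⟨Y, hY⟩ : ∃ Y : K →L[ℂ] H, ∀ ψ, Y (V ψ) = X ψ := by
    refine exists_comp_eq_of_norm_le hV (M := M * ‖V‖) fun ψ => ?_
    rcases (norm_nonneg (X ψ)).eq_or_lt with h0 | h0
    · rw [← h0]; positivity
    · have h1 := hX (X ψ) ψ
      rw [inner_self_eq_norm_sq_to_K, norm_pow, RCLike.norm_ofReal, abs_norm] at h1
      refine le_of_mul_le_mul_left ?_ h0
      calc ‖X ψ‖ * ‖X ψ‖ = ‖X ψ‖ ^ 2 := (sq _).symm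
        _ ≤ M * ‖V (X ψ)‖ * ‖V ψ‖ := h1
        _ ≤ M * (‖V‖ * ‖X ψ‖) * ‖V ψ‖ := by gcongr; exact le_opNorm _ _
        _ = _ := by ring
  have hY' : ∀ φ η, ‖⟪φ, Y η⟫_ℂ‖ ≤ M * ‖V φ‖ * ‖η‖ := fun φ η =>
    hV.induction_on (p := fun η => ‖⟪φ, Y η⟫_ℂ‖ ≤ M * ‖V φ‖ * ‖η‖) η
      (isClosed_le (by fun_prop) (by fun_prop)) fun ψ => by rw [hY]; exact hX φ ψ
  obtain ⟨Z, hZ⟩ : ∃ Z : K →L[ℂ] K, ∀ φ, Z (V φ) = adjoint Y φ := by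
    refine exists_comp_eq_of_norm_le hV (M := M) fun φ => ?_
    rcases (norm_nonneg (adjoint Y φ)).eq_or_lt with h0 | h0
    · rw [← h0]; positivity
    · have h1 := hY' φ (adjoint Y φ)
      rw [← adjoint_inner_left, inner_self_eq_norm_sq_to_K, norm_pow, RCLike.norm_ofReal,
        abs_norm, sq] at h1
      exact le_of_mul_le_mul_right h1 h0
  refine ⟨adjoint Z, fun φ ψ => ?_⟩
  rw [adjoint_inner_right, hZ, adjoint_inner_left, hY]

end

/-! ### Radon–Nikodym derivatives with prescribed value at the unit -/

namespace NormalCPMap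
variable {K : Type*} [NormedAddCommGroup K] [InnerProductSpace ℂ K] [CompleteSpace K]
  {H : Type*} [NormedAddCommGroup H] [InnerProductSpace ℂ H] [CompleteSpace H]
  {L : Type*} [NormedAddCommGroup L] [InnerProductSpace ℂ L] [CompleteSpace L]

/-- A Radon–Nikodym theorem for normal completely positive maps. -/
theorem exists_inner_eq_of_denseRange (Φ : NormalCPMap L H) {V : H →L[ℂ] K}
    (hV : Φ 1 = adjoint V ∘L V) (hd : DenseRange V) :
    ∃ F : NormalCPMap L K, F 1 = 1 ∧ ∀ C φ ψ, ⟪V φ, F C (V ψ)⟫_ℂ = ⟪φ, Φ C ψ⟫_ℂ := by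
  choose S hS using fun C => exists_inner_eq_of_norm_inner_le hd (norm_nonneg C)
    (Φ.norm_inner_le hV C)
  let F : (L →L[ℂ] L) →ₗ[ℂ] K →L[ℂ] K :=
    { toFun := S
      map_add' C C' := clm_ext_of_denseRange hd fun φ ψ => by
        simp only [hS, add_apply, inner_add_right, map_add]
      map_smul' c C := clm_ext_of_denseRange hd fun φ ψ => by
        simp only [hS, smul_apply, inner_smul_right, map_smul, RingHom.id_apply] }
  have hF : ∀ C φ ψ, ⟪V φ, F C (V ψ)⟫_ℂ = ⟪φ, Φ C ψ⟫_ℂ := hS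
  have hpos : ∀ (k : ℕ) (M : CStarMatrix (Fin k) (Fin k) (L →L[ℂ] L)), 0 ≤ M →
      ∀ v : Fin k → K, 0 ≤ ∑ i, ∑ j, ⟪v i, F (M i j) (v j)⟫_ℂ := by
    intro k M hM v
    refine (DenseRange.piMap fun _ : Fin k => hd).induction_on
      (p := fun v : Fin k → K => 0 ≤ ∑ i, ∑ j, ⟪v i, F (M i j) (v j)⟫_ℂ) v
      (isClosed_le (by fun_prop) (by fun_prop)) fun w => ?_
    simpa only [Pi.map_apply, hF] using Φ.sum_inner_nonneg hM w
  have hmono := monotone_of_sum_inner_nonneg hpos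
  refine ⟨ofForm F hpos ?_, ?_, hF⟩
  · intro d hne hdir a ha
    refine ⟨?_, fun b hb => clm_le_of_denseRange hd fun φ => ?_⟩
    · rintro _ ⟨c, hc, rfl⟩
      exact hmono (ha.1 hc)
    -- Normality is inherited from `Φ`: an upper bound `b` of the values of `F` compresses to an
    -- upper bound of the values of `Φ`.
    · have hub : adjoint V ∘L b ∘L V ∈ upperBounds ((fun C => Φ C) '' d) := by
        rintro _ ⟨c, hc, rfl⟩
        refine clm_le_iff_inner.mpr fun φ => ?_
        simpa only [ContinuousLinearMap.comp_apply, adjoint_inner_right, hF] using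
          clm_le_iff_inner.mp (hb (Set.mem_image_of_mem F hc)) (V φ)
      simpa only [ContinuousLinearMap.comp_apply, adjoint_inner_right, hF] using
        clm_le_iff_inner.mp ((Φ.normal hne hdir ha).2 hub) φ
  · refine clm_ext_of_denseRange hd fun φ ψ => (hF 1 φ ψ).trans ?_
    rw [hV, ContinuousLinearMap.comp_apply, adjoint_inner_right, one_apply_eq_self]

/-- By Parseval this is the sum of the conjugations by the rank-one operators `φ ↦ ⟪B* b_i, φ⟫ e`
over a Hilbert basis `b`. -/
theorem exists_eq_inner_smul (e : L) (B : H →L[ℂ] K) :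
    ∃ Φ : NormalCPMap L H, ∀ C, Φ C = ⟪e, C e⟫_ℂ • (adjoint B ∘L B) := by
  obtain ⟨w, b, -⟩ := exists_hilbertBasis ℂ K
  have hsum : ∀ C, HasWeakSum (fun i => conj (InnerProductSpace.rankOne ℂ e (adjoint B (b i))) C)
      (⟪e, C e⟫_ℂ • (adjoint B ∘L B)) := by
    intro C φ ψ
    have h := (b.hasSum_inner_mul_inner (B φ) (B ψ)).mul_left ⟪e, C e⟫_ℂ
    simp only [conj_apply, ContinuousLinearMap.comp_apply, adjoint_inner_right, smul_apply,
      inner_smul_right, InnerProductSpace.rankOne_apply, map_smul, inner_smul_left,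
      adjoint_inner_left, inner_conj_symm] at h ⊢
    exact h.congr_fun fun i => by ring
  obtain ⟨Φ, hΦ⟩ := exists_hasWeakSum _ (hsum 1)
  exact ⟨Φ, fun C => (hΦ C).unique (hsum C)⟩

/-- The sum of two normal completely positive maps. -/
theorem exists_eq_add (Φ Ψ : NormalCPMap K H) : ∃ Θ : NormalCPMap K H, ∀ C, Θ C = Φ C + Ψ C := by
  have hsum : ∀ C, HasWeakSum (fun i => (bif i then Φ else Ψ) C) (Φ C + Ψ C) := by
    intro C φ ψ
    have h := hasSum_fintype fun i => ⟪φ, (bif i then Φ else Ψ) C ψ⟫_ℂ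
    rwa [Fintype.sum_bool, cond_true, cond_false, ← inner_add_right, ← add_apply] at h
  obtain ⟨Θ, hΘ⟩ := exists_hasWeakSum (fun i => bif i then Φ else Ψ) (hsum 1)
  exact ⟨Θ, fun C => (hΘ C).unique (hsum C)⟩

/-- The derivative on the closed range of `V` has the range projection `P ≤ Q` as its value at the
unit. Adding `C ↦ ⟪e, C e⟫ (Q - P)`, with `e` a unit vector, corrects this to `Q` and is invisible
on the range of `V`. -/
theorem exists_map_one_eq_of_isStarProjection [Nontrivial L] (Φ : NormalCPMap L H) {V : H →L[ℂ] K}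
    (hV : Φ 1 = adjoint V ∘L V) {Q : K →L[ℂ] K} (hQ : IsStarProjection Q) (hQV : Q ∘L V = V) :
    ∃ F : NormalCPMap L K, F 1 = Q ∧ ∀ C φ ψ, ⟪V φ, F C (V ψ)⟫_ℂ = ⟪φ, Φ C ψ⟫_ℂ := by
  let U : Submodule ℂ K := (LinearMap.range V.toLinearMap).topologicalClosure
  have : CompleteSpace U := (Submodule.isClosed_topologicalClosure _).completeSpace_coe
  let ι : U →L[ℂ] K := U.subtypeL
  let V' : H →L[ℂ] U := V.codRestrict U fun φ =>
    Submodule.le_topologicalClosure _ (LinearMap.mem_range_self V.toLinearMap φ)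
  have hιV : ∀ φ, ι (V' φ) = V φ := fun _ => rfl
  have hd : DenseRange V' := by
    rintro ⟨x, hx⟩
    rw [closure_subtype, ← Set.range_comp]
    exact hx
  have hinner : ∀ x y : U, ⟪ι x, ι y⟫_ℂ = ⟪x, y⟫_ℂ := fun _ _ => rfl
  have hιι : adjoint ι ∘L ι = 1 := ContinuousLinearMap.ext fun x => ext_inner_left ℂ fun y => by
    rw [ContinuousLinearMap.comp_apply, adjoint_inner_right, hinner, one_apply_eq_self]
  have hV' : Φ 1 = adjoint V' ∘L V' := by
    rw [hV]
    refine ContinuousLinearMap.ext fun x => ext_inner_left ℂ fun y => ?_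
    simp only [ContinuousLinearMap.comp_apply, adjoint_inner_right, ← hιV, hinner]
  obtain ⟨F₀, h1, h2⟩ := Φ.exists_inner_eq_of_denseRange hV' hd
  have hQι : Q ∘L ι = ι := ContinuousLinearMap.ext fun x =>
    hd.induction_on (p := fun x => Q (ι x) = ι x) x
      (isClosed_eq (by fun_prop) (by fun_prop)) fun φ => congrArg (· φ) hQV
  set P : K →L[ℂ] K := ι ∘L adjoint ι with hP
  have hPP : P * P = P := by
    change ι ∘L (adjoint ι ∘L ι) ∘L adjoint ι = P
    rw [hιι]; rfl
  have hPs : star P = P := by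
    rw [star_eq_adjoint, hP, adjoint_comp, adjoint_adjoint]
  have hQP : Q * P = P := by
    change (Q ∘L ι) ∘L adjoint ι = P
    rw [hQι]
  have hPQ : P * Q = P := by
    have := congrArg star hQP
    rwa [star_mul, hPs, hQ.isSelfAdjoint.star_eq] at this
  have hB : adjoint (Q - P) ∘L (Q - P) = Q - P := by
    change star (Q - P) * (Q - P) = Q - P
    rw [star_sub, hPs, hQ.isSelfAdjoint.star_eq, mul_sub, sub_mul, sub_mul, hPQ, hQP, hPP,
      hQ.isIdempotentElem.eq]
    abel
  obtain ⟨e, he⟩ := exists_norm_eq L zero_le_one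
  obtain ⟨G, hG⟩ := exists_eq_inner_smul e (Q - P)
  obtain ⟨F, hF⟩ := exists_eq_add ((conj (adjoint ι)).comp F₀) G
  refine ⟨F, ?_, fun C φ ψ => ?_⟩
  · rw [hF, hG, hB, comp_apply, h1, conj_apply, adjoint_adjoint, one_apply_eq_self,
      inner_self_eq_norm_sq_to_K, he]
    change P + _ = Q
    simp
  · have hPV : (Q - P) (V ψ) = 0 := by
      have hQ1 : Q (V ψ) = V ψ := congrArg (· ψ) hQV
      have hP1 : P (V ψ) = V ψ := congrArg (fun T : U →L[ℂ] U => ι (T (V' ψ))) hιι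
      rw [sub_apply, hQ1, hP1, sub_self]
    have hιV' : ∀ φ, adjoint ι (V φ) = V' φ := fun φ => congrArg (· (V' φ)) hιι
    rw [hF, hG, hB, add_apply, smul_apply, hPV, smul_zero, add_zero, comp_apply, conj_apply,
      ContinuousLinearMap.comp_apply, adjoint_inner_right, ContinuousLinearMap.comp_apply,
      hιV', hιV', h2]

end NormalCPMap

/-! ### Naimark dilations and the factorization of `A`-channels -/

section
variable {K : Type*} [NormedAddCommGroup K] [InnerProductSpace ℂ K] [CompleteSpace K]
  {H : Type*} [NormedAddCommGroup H] [InnerProductSpace ℂ H] [CompleteSpace H]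
  {L : Type*} [NormedAddCommGroup L] [InnerProductSpace ℂ L] [CompleteSpace L]

theorem Channel.ext {Φ Ψ : Channel K H} (h : ∀ C, Φ C = Ψ C) : Φ = Ψ := by
  obtain ⟨Φ, _⟩ := Φ
  obtain ⟨Ψ, _⟩ := Ψ
  obtain rfl : Φ = Ψ := NormalCPMap.ext h
  rfl

theorem Channel.nontrivial [Nontrivial H] (Φ : Channel K H) : Nontrivial K := by
  by_contra hK
  rw [not_nontrivial_iff_subsingleton] at hK
  have h : Φ 1 = Φ 0 := congrArg (fun C => Φ C) (Subsingleton.elim _ _)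
  rw [Φ.map_one, map_zero] at h
  exact one_ne_zero h

/-- The effects of a projection-valued measure are pairwise orthogonal. -/
theorem Observable.effect_apply_effect_apply (E : Observable K)
    (hE : ∀ x, IsStarProjection (E.effect x)) {x y : ℕ} (hxy : x ≠ y) (ξ : K) :
    E.effect y (E.effect x ξ) = 0 := by
  have hsq : ∀ z η, ⟪η, E.effect z η⟫_ℂ = ((‖E.effect z η‖ ^ 2 : ℝ) : ℂ) := by
    intro z η
    have h1 : E.effect z (E.effect z η) = E.effect z η :=
      congrArg (· η) (hE z).isIdempotentElem.eq
    nth_rw 1 [← h1]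
    rw [← adjoint_inner_left, ← star_eq_adjoint, (hE z).isSelfAdjoint.star_eq,
      inner_self_eq_norm_sq_to_K]
    simp
  -- At `η = E(x) ξ` the identity `‖η‖² = ∑ ‖E(z) η‖²` is exhausted by the term `z = x`.
  have h := E.sum_effect (E.effect x ξ) (E.effect x ξ)
  simp only [hsq, one_apply_eq_self, inner_self_eq_norm_sq_to_K, Complex.coe_algebraMap,
    ← Complex.ofReal_pow, Complex.hasSum_ofReal] at h
  have h1 : E.effect x (E.effect x ξ) = E.effect x ξ := congrArg (· ξ) (hE x).isIdempotentElem.eq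
  have h2 := sum_le_hasSum {x, y} (fun z _ => sq_nonneg _) h
  rw [Finset.sum_pair hxy, h1] at h2
  exact norm_eq_zero.mp (pow_eq_zero_iff two_ne_zero |>.mp
    (le_antisymm (by linarith) (sq_nonneg ‖E.effect y (E.effect x ξ)‖)))

namespace NaimarkDilation
variable {A : Observable H} (D : NaimarkDilation A K)

/-- The operator `pvm(x) J`. -/
noncomputable def block (x : ℕ) : H →L[ℂ] K := D.pvm.effect x ∘L D.isom.toContinuousLinearMap

theorem adjoint_block (x : ℕ) :
    adjoint (D.block x) = adjoint D.isom.toContinuousLinearMap ∘L D.pvm.effect x := by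
  rw [block, adjoint_comp, ← star_eq_adjoint (D.pvm.effect x),
    (D.isStarProjection_pvm x).isSelfAdjoint.star_eq]

theorem term_eq_conj (x : ℕ) (C : K →L[ℂ] K) : D.term x C = NormalCPMap.conj (D.block x) C := by
  rw [NormalCPMap.conj_apply, adjoint_block]
  rfl

theorem effect_comp_block (x : ℕ) : D.pvm.effect x ∘L D.block x = D.block x := by
  change (D.pvm.effect x * D.pvm.effect x) ∘L _ = _
  rw [(D.isStarProjection_pvm x).isIdempotentElem.eq]
  rfl

theorem adjoint_block_comp_block (x : ℕ) : adjoint (D.block x) ∘L D.block x = A.effect x := by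
  rw [adjoint_block, ContinuousLinearMap.comp_assoc, effect_comp_block, ← D.compress x]
  rfl

theorem conj_block_one (x : ℕ) : NormalCPMap.conj (D.block x) 1 = A.effect x :=
  D.adjoint_block_comp_block x

theorem exists_channel :
    ∃ Λ : Channel K H, ∀ C : K →L[ℂ] K, HasWeakSum (fun x => D.term x C) (Λ C) := by
  have h1 : HasWeakSum (fun x => NormalCPMap.conj (D.block x) 1) (1 : H →L[ℂ] H) := by
    simpa only [conj_block_one] using A.sum_effect
  obtain ⟨Φ, hΦ⟩ := NormalCPMap.exists_hasWeakSum _ h1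
  exact ⟨⟨Φ, (hΦ 1).unique h1⟩, fun C => by simpa only [term_eq_conj] using hΦ C⟩

variable {D} {Λ : Channel K H}

theorem isAChannel_comp (hΛ : ∀ C : K →L[ℂ] K, HasWeakSum (fun x => D.term x C) (Λ C))
    (E : Channel L K) : IsAChannel A (Λ.comp E) := by
  refine ⟨⟨fun x => (NormalCPMap.conj (D.block x)).comp E.toNormalCPMap, Λ.comp E, fun C => ?_⟩,
    fun x => ?_, rfl⟩
  · simpa only [term_eq_conj] using! hΛ (E C)
  · rw [NormalCPMap.comp_apply, E.map_one, conj_block_one]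

theorem exists_eq_comp [Nontrivial H]
    (hΛ : ∀ C : K →L[ℂ] K, HasWeakSum (fun x => D.term x C) (Λ C))
    {Γ : Channel L H} (hΓ : IsAChannel A Γ) :
    ∃ E : Channel L K, Γ = Λ.comp E := by
  obtain ⟨I, hI, rfl⟩ := hΓ
  have := I.total.nontrivial
  choose F hF1 hF using fun x => (I.op x).exists_map_one_eq_of_isStarProjection
    ((hI x).trans (D.adjoint_block_comp_block x).symm) (D.isStarProjection_pvm x)
    (D.effect_comp_block x)
  have hsum : HasWeakSum (fun x => F x 1) (1 : K →L[ℂ] K) := by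
    simpa only [hF1] using D.pvm.sum_effect
  obtain ⟨E, hE⟩ := NormalCPMap.exists_hasWeakSum F hsum
  refine ⟨⟨E, (hE 1).unique hsum⟩, Channel.ext fun C => ?_⟩
  -- `E` reproduces the instrument outcome by outcome, not only its total channel.
  suffices h : ∀ x, D.term x (E C) = I.op x C from
    (I.hasWeakSum_op C).unique (by simpa only [h] using! hΛ (E C))
  intro x
  refine ContinuousLinearMap.ext fun ψ => ext_inner_left ℂ fun φ => ?_
  rw [term_eq_conj, NormalCPMap.conj_apply, ContinuousLinearMap.comp_apply, adjoint_inner_right,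
    ContinuousLinearMap.comp_apply, ← hF]
  -- Only `F x` contributes between vectors in the range of `pvm(x)`: for `y ≠ x` the Schwarz
  -- inequality with `F y 1 = pvm(y)` bounds the term by zero.
  refine (hE C (D.block x φ) (D.block x ψ)).unique (hasSum_single x fun y hy => ?_)
  have hQ : F y 1 = adjoint (D.pvm.effect y) ∘L D.pvm.effect y := by
    rw [hF1, ← star_eq_adjoint, (D.isStarProjection_pvm y).isSelfAdjoint.star_eq]
    exact (D.isStarProjection_pvm y).isIdempotentElem.eq.symm
  have h0 : D.pvm.effect y (D.block x φ) = 0 :=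
    D.pvm.effect_apply_effect_apply D.isStarProjection_pvm hy.symm _
  have hle := (F y).norm_inner_le hQ C (D.block x φ) (D.block x ψ)
  rw [h0, norm_zero, mul_zero, zero_mul] at hle
  exact norm_le_zero_iff.mp hle

end NaimarkDilation
end
end QuantumMeasurement

open QuantumMeasurement

theorem theorem1
    {H : Type u} [NormedAddCommGroup H] [InnerProductSpace ℂ H] [CompleteSpace H]
    [TopologicalSpace.SeparableSpace H] [Nontrivial H]
    (A : Observable H)
    {K : Type v} [NormedAddCommGroup K] [InnerProductSpace ℂ K] [CompleteSpace K]
    (D : NaimarkDilation A K) :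
    ∃ ΛA : Channel K H,
      (∀ C : K →L[ℂ] K, HasWeakSum (fun x => D.term x C) (ΛA C)) ∧
      aChannels A = {Λ : ChannelTo.{u, v} H | Λ ≤ ChannelTo.mk K ΛA} ∧
      IsGreatest (aChannels A) (ChannelTo.mk K ΛA) ∧
      IsGreatest (aChannelClasses A) (channelClass (ChannelTo.mk K ΛA)) ∧
      aChannelClasses A =
        {c : ChannelClass.{u, v} H | c ≤ channelClass (ChannelTo.mk K ΛA)} ∧
      aChannelClasses A =
        (Order.Ideal.principal (channelClass (ChannelTo.mk K ΛA)) :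
          Set (ChannelClass.{u, v} H)) := by
  obtain ⟨ΛA, hΛ⟩ := D.exists_channel
  have h1 : aChannels A = {Λ : ChannelTo.{u, v} H | Λ ≤ ChannelTo.mk K ΛA} := by
    ext Γ
    refine ⟨fun h => NaimarkDilation.exists_eq_comp hΛ h, fun ⟨E, hE⟩ => ?_⟩
    change IsAChannel A Γ.chan
    rw [hE]
    exact NaimarkDilation.isAChannel_comp hΛ E
  have h2 : aChannelClasses A =
      {c : ChannelClass.{u, v} H | c ≤ channelClass (ChannelTo.mk K ΛA)} := by
    rw [aChannelClasses, h1]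
    ext c
    constructor
    · rintro ⟨Γ, hΓ, rfl⟩
      exact hΓ
    · induction c using Quotient.inductionOn with
      | h Γ => exact fun h => ⟨Γ, h, rfl⟩
  refine ⟨ΛA, hΛ, h1, ?_, ?_, h2, ?_⟩
  · rw [h1]
    exact isGreatest_Iic
  · rw [h2]
    exact isGreatest_Iic
  · rw [h2]
    rfl
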